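/- A subgroup $K$ of a group $G$ is a permutable complement of a subgroup $H$ in $G$ if $G=HK$ and $H\cap K=1$. A group is a $C$-group if every subgroup has a permutable complement, and a profinite group is profinite-$C$ if every closed subgroup has a closed permutable complement. Proposition. Let $G$ be a profinite-$C$ group such that the topological closure $\overline{G'}$ of the derived subgroup $G'$ is an open subgroup of $G$. Then $G$ is a $C$-group if and only if $G$ is a torsion group (that is, every element of $G$ has finite order). -/

import Mathlib

open scoped Pointwise

/-- `K` is a permutable complement of `H` in `G`: `G = HK` and `H ∩ K = 1`. -/
def IsPermutableComplement {G : Type*} [Group G] (H K : Subgroup G) : Prop :=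
  (H : Set G) * (K : Set G) = Set.univ ∧ H ⊓ K = ⊥

/-- `G` is a `C`-group: every subgroup of `G` has a permutable complement. -/
def IsCGroup (G : Type*) [Group G] : Prop :=
  ∀ H : Subgroup G, ∃ K : Subgroup G, IsPermutableComplement H K

/-- `G` is a profinite-`C` group: a profinite group (a compact, totally disconnected topological
group; such a group is automatically Hausdorff) in which every closed subgroup has a closed
permutable complement. -/
structure IsProfiniteCGroup (G : Type*) [Group G] [TopologicalSpace G] : Prop where
  isTopologicalGroup : IsTopologicalGroup G
  compactSpace : CompactSpace G
  totallyDisconnectedSpace : TotallyDisconnectedSpace G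
  exists_closed_complement : ∀ H : Subgroup G, IsClosed (H : Set G) →
    ∃ K : Subgroup G, IsClosed (K : Set G) ∧ IsPermutableComplement H K

namespace IsPermutableComplement

variable {G : Type*} [Group G] {H K N : Subgroup G}

/-! In an infinite cyclic group the squares have no complement, so C-groups are torsion. Conversely,
finite C-groups are metabelian, hence so is `G`, and the closure `D` of the derived subgroup is
abelian, open and of finite index. Torsion makes normal closures of elements of `D` finite; finite
subgroups are closed, hence complemented, so `D` is generated by normal subgroups of `G` of prime
order. Given `H`, this yields a normal `L ≤ D` with `H ∩ L = 1` and `D ≤ HL`. As `HD` is open, it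
has a complement `C`, and `LC` complements `H`. -/

theorem exists_mul_eq (h : IsPermutableComplement H K) (x : G) :
    ∃ a ∈ H, ∃ b ∈ K, a * b = x := by
  have hx : x ∈ (H : Set G) * (K : Set G) := h.1 ▸ Set.mem_univ x
  exact Set.mem_mul.1 hx

theorem eq_one (h : IsPermutableComplement H K) {x : G} (hH : x ∈ H) (hK : x ∈ K) : x = 1 := by
  have hx : x ∈ H ⊓ K := ⟨hH, hK⟩
  rwa [h.2, Subgroup.mem_bot] at hx

theorem mk' (h : ∀ x, ∃ a ∈ H, ∃ b ∈ K, a * b = x) (h' : ∀ x ∈ H, x ∈ K → x = 1) :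
    IsPermutableComplement H K :=
  ⟨Set.eq_univ_of_forall fun x => Set.mem_mul.2 (h x),
    (Subgroup.eq_bot_iff_forall _).2 fun x hx => h' x hx.1 hx.2⟩

/-- Dedekind's modular law for permutable complements. -/
theorem exists_mul_eq_of_le (h : IsPermutableComplement H K) (hHN : H ≤ N) {x : G} (hx : x ∈ N) :
    ∃ a ∈ H, ∃ b ∈ K ⊓ N, a * b = x := by
  obtain ⟨a, ha, b, hb, rfl⟩ := h.exists_mul_eq x
  exact ⟨a, ha, b, ⟨hb, (Subgroup.mul_mem_cancel_left N (hHN ha)).1 hx⟩, rfl⟩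

theorem subgroupOf {H : Subgroup N} (h : IsPermutableComplement (H.map N.subtype) K) :
    IsPermutableComplement H (K.subgroupOf N) := by
  refine mk' (fun x => ?_) fun x hH hK => ?_
  · obtain ⟨a, ha, b, hb, hab⟩ := h.exists_mul_eq_of_le (Subgroup.map_subtype_le H) x.2
    obtain ⟨a, ha', rfl⟩ := Subgroup.mem_map.1 ha
    exact ⟨a, ha', ⟨b, hb.2⟩, hb.1, Subtype.ext hab⟩
  · exact Subtype.ext (h.eq_one (Subgroup.mem_map_of_mem _ hH) hK)

theorem map {Q : Type*} [Group Q] {f : G →* Q} (hf : Function.Surjective f) {H : Subgroup Q}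
    (h : IsPermutableComplement (H.comap f) K) : IsPermutableComplement H (K.map f) := by
  refine mk' (fun x => ?_) ?_
  · obtain ⟨x, rfl⟩ := hf x
    obtain ⟨a, ha, b, hb, rfl⟩ := h.exists_mul_eq x
    exact ⟨f a, ha, f b, Subgroup.mem_map_of_mem _ hb, (map_mul f a b).symm⟩
  · rintro _ hH ⟨x, hK, rfl⟩
    rw [h.eq_one hH hK, map_one]

/-- If `N` is normal and `H` centralizes `K ⊓ N`, then `K ⊓ N` is normal. -/
theorem normal_inf (h : IsPermutableComplement H K) [hN : N.Normal]
    (hc : ∀ a ∈ H, ∀ b ∈ K ⊓ N, a * b = b * a) : (K ⊓ N).Normal := by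
  refine ⟨fun n hn g => ?_⟩
  obtain ⟨a, ha, b, hb, rfl⟩ := h.exists_mul_eq g
  have hbn : b * n * b⁻¹ ∈ K ⊓ N :=
    ⟨K.mul_mem (K.mul_mem hb hn.1) (K.inv_mem hb), hN.conj_mem n hn.2 b⟩
  have : a * b * n * (a * b)⁻¹ = b * n * b⁻¹ := by
    rw [mul_inv_rev, show a * b * n * (b⁻¹ * a⁻¹) = a * (b * n * b⁻¹) * a⁻¹ by group,
      hc a ha _ hbn, mul_inv_cancel_right]
  rwa [this]

end IsPermutableComplement

/-! ### Normal subgroups of prime order -/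

section FiniteComplements

variable {G : Type*} [Group G]

theorem IsCGroup.subgroup (h : IsCGroup G) (N : Subgroup G) : IsCGroup N := fun H =>
  let ⟨_, hK⟩ := h (H.map N.subtype)
  ⟨_, hK.subgroupOf⟩

theorem IsCGroup.of_surjective (h : IsCGroup G) {Q : Type*} [Group Q] (f : G →* Q)
    (hf : Function.Surjective f) : IsCGroup Q := fun H =>
  let ⟨_, hK⟩ := h (H.comap f)
  ⟨_, hK.map hf⟩

/-- A complement of a prime-order subgroup of `N` meets `N` in a smaller subgroup, normal because
`N` is abelian; descend until it is trivial. -/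
theorem exists_normal_card_prime_le
    (hG : ∀ H : Subgroup G, Finite H → ∃ K, IsPermutableComplement H K)
    (N : Subgroup G) [N.Normal] [Finite N] (hcomm : ∀ a ∈ N, ∀ b ∈ N, a * b = b * a)
    (hN : N ≠ ⊥) : ∃ M ≤ N, M.Normal ∧ (Nat.card M).Prime := by
  induction hn : Nat.card N using Nat.strong_induction_on generalizing N with
  | _ n ih =>
  have hcard : Nat.card N ≠ 1 := fun h => hN (Subgroup.card_eq_one.1 h)
  obtain ⟨p, hp, hpN⟩ := Nat.exists_prime_and_dvd hcard
  have := Fact.mk hp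
  obtain ⟨x, hx⟩ := exists_prime_orderOf_dvd_card' p hpN
  let C := Subgroup.zpowers (x : G)
  have hCcard : Nat.card C = p := by
    rw [Nat.card_zpowers, Subgroup.orderOf_coe, hx]
  have hCN : C ≤ N := by simp [C]
  obtain ⟨K, hK⟩ := hG C (Nat.finite_of_card_ne_zero (hCcard ▸ hp.ne_zero))
  have hT : (K ⊓ N).Normal := hK.normal_inf fun a ha b hb => hcomm a (hCN ha) b hb.2
  by_cases hbot : K ⊓ N = ⊥
  · refine ⟨N, le_rfl, inferInstance, ?_⟩
    have : N ≤ C := fun y hy => by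
      obtain ⟨a, ha, b, hb, rfl⟩ := hK.exists_mul_eq_of_le hCN hy
      rw [hbot, Subgroup.mem_bot] at hb
      rwa [hb, mul_one]
    rwa [le_antisymm this hCN, hCcard]
  · have hlt : K ⊓ N < N := by
      refine lt_of_le_of_ne inf_le_right fun h => hp.one_lt.ne' ?_
      rw [← hCcard, Subgroup.card_eq_one, ← hK.2]
      exact (inf_eq_left.2 (hCN.trans (h ▸ inf_le_left))).symm
    have : Finite (K ⊓ N : Subgroup G) := Finite.of_injective _
      (Subgroup.inclusion_injective (inf_le_right : K ⊓ N ≤ N))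
    obtain ⟨M, hM, hM'⟩ := ih _ (hn ▸ Set.Finite.card_lt_card (Set.toFinite (N : Set G)) hlt)
      (K ⊓ N) (fun a ha b hb => hcomm a ha.2 b hb.2) hbot rfl
    exact ⟨M, hM.trans inf_le_right, hM'⟩

theorem le_sSup_normal_card_prime
    (hG : ∀ H : Subgroup G, Finite H → ∃ K, IsPermutableComplement H K)
    (N : Subgroup G) [N.Normal] [Finite N] (hcomm : ∀ a ∈ N, ∀ b ∈ N, a * b = b * a) :
    N ≤ sSup {M | M ≤ N ∧ M.Normal ∧ (Nat.card M).Prime} := by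
  set S := sSup {M | M ≤ N ∧ M.Normal ∧ (Nat.card M).Prime} with hS
  have hSN : S ≤ N := sSup_le fun M hM => hM.1
  have hfin {T : Subgroup G} (h : T ≤ N) : Finite T :=
    Finite.of_injective _ (Subgroup.inclusion_injective h)
  obtain ⟨K, hK⟩ := hG S (hfin hSN)
  have hT : (K ⊓ N).Normal := hK.normal_inf fun a ha b hb => hcomm a (hSN ha) b hb.2
  have hbot : K ⊓ N = ⊥ := by
    by_contra hne
    have := hfin (inf_le_right : K ⊓ N ≤ N)
    obtain ⟨M, hM, hMn, hMp⟩ := exists_normal_card_prime_le hG (K ⊓ N)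
      (fun a ha b hb => hcomm a ha.2 b hb.2) hne
    have hMS : M ≤ S := le_sSup ⟨hM.trans inf_le_right, hMn, hMp⟩
    have : M ≤ ⊥ := hK.2 ▸ le_inf hMS (hM.trans inf_le_left)
    rw [le_bot_iff.1 this, Subgroup.card_bot] at hMp
    exact Nat.not_prime_one hMp
  intro y hy
  obtain ⟨a, ha, b, hb, rfl⟩ := hK.exists_mul_eq_of_le hSN hy
  rw [hbot, Subgroup.mem_bot] at hb
  rwa [hb, mul_one]

end FiniteComplements

/-! ### Finite C-groups -/

section FiniteGroups

/-- A complement of a subgroup of order the least prime divisor has that prime as index, hence is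
normal. -/
theorem IsCGroup.isSolvable {G : Type*} [Group G] [Finite G] (h : IsCGroup G) : Group.IsSolvable G := by
  induction hn : Nat.card G using Nat.strong_induction_on generalizing G with
  | _ n ih =>
  subst hn
  rcases subsingleton_or_nontrivial G with _ | _
  · infer_instance
  have hcard : Nat.card G ≠ 1 := Finite.one_lt_card.ne'
  have hp := Nat.minFac_prime hcard
  have := Fact.mk hp
  obtain ⟨x, hx⟩ := exists_prime_orderOf_dvd_card' _ (Nat.minFac_dvd (Nat.card G))
  obtain ⟨K, hK⟩ := h (Subgroup.zpowers x)
  have hc : (Subgroup.zpowers x).IsComplement' K :=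
    Subgroup.isComplement'_of_disjoint_and_mul_eq_univ (disjoint_iff.2 hK.2) hK.1
  have hidx : K.index = (Nat.card G).minFac := by
    rw [hc.index_eq_card, Nat.card_zpowers, hx]
  have hKn : K.Normal := Subgroup.normal_of_index_eq_minFac_card hidx
  have hlt : Nat.card K < Nat.card G := by
    rw [← K.card_mul_index, hidx]
    exact lt_mul_of_one_lt_right Nat.card_pos hp.one_lt
  have := ih _ hlt (h.subgroup K) rfl
  have : IsCyclic (G ⧸ K) := isCyclic_of_prime_card (p := (Nat.card G).minFac) hidx
  have : Group.IsSolvable (G ⧸ K) := Group.isSolvable_of_comm fun a b => mul_comm' a b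
  exact Group.isSolvable_of_ker_le_range K.subtype (QuotientGroup.mk' K) (by simp)

/-- The automorphism group of a cyclic group is abelian. -/
theorem commutator_le_centralizer_of_isCyclic {G : Type*} [Group G] (M : Subgroup G) [M.Normal]
    [IsCyclic M] : commutator G ≤ Subgroup.centralizer (M : Set G) := by
  let f : G →* (ZMod (Nat.card M))ˣ :=
    (IsCyclic.mulAutMulEquiv M).toMonoidHom.comp MulAut.conjNormal
  intro g hg
  have h1 : f g = 1 := Abelianization.commutator_subset_ker f hg
  have h2 : (MulAut.conjNormal g : MulAut M) = 1 :=
    (IsCyclic.mulAutMulEquiv M).injective (h1.trans (map_one _).symm)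
  rw [Subgroup.mem_centralizer_iff]
  intro m hm
  have h3 := congrArg Subtype.val (DFunLike.congr_fun h2 ⟨m, hm⟩)
  rw [MulAut.conjNormal_apply] at h3
  exact (mul_inv_eq_iff_eq_mul.1 h3).symm

theorem exists_normal_abelian_ne_bot (G : Type*) [Group G] [Nontrivial G] [h : Group.IsSolvable G] :
    ∃ N : Subgroup G, N.Normal ∧ N ≠ ⊥ ∧ ∀ a ∈ N, ∀ b ∈ N, a * b = b * a := by
  classical
  have hex := h.solvable
  have hbot := Nat.find_spec hex
  obtain ⟨k, hk⟩ : ∃ k, Nat.find hex = k + 1 := by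
    refine Nat.exists_eq_succ_of_ne_zero fun h0 => ?_
    rw [h0, derivedSeries_zero] at hbot
    exact top_ne_bot hbot
  refine ⟨derivedSeries G k, inferInstance, Nat.find_min hex (by omega), fun a ha b hb => ?_⟩
  rw [hk, derivedSeries_succ] at hbot
  have := Subgroup.commutator_mem_commutator ha hb
  rw [hbot, Subgroup.mem_bot] at this
  exact commutatorElement_eq_one_iff_mul_comm.1 this

theorem derivedSeries_le_of_quotient {G : Type*} [Group G] {n : ℕ} (M : Subgroup G) [M.Normal]
    (h : derivedSeries (G ⧸ M) n = ⊥) : derivedSeries G n ≤ M := by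
  rw [← QuotientGroup.ker_mk' M, ← Subgroup.map_eq_bot_iff, eq_bot_iff, ← h]
  exact map_derivedSeries_le_derivedSeries _ _

/-- A finite `C`-group is metabelian. -/
theorem IsCGroup.derivedSeries_two_eq_bot {G : Type*} [Group G] [Finite G] (h : IsCGroup G) :
    derivedSeries G 2 = ⊥ := by
  induction hn : Nat.card G using Nat.strong_induction_on generalizing G with
  | _ n ih =>
  subst hn
  rcases subsingleton_or_nontrivial G with _ | _
  · exact Subsingleton.elim _ _
  have := h.isSolvable
  obtain ⟨N, hN, hNbot, hNcomm⟩ := exists_normal_abelian_ne_bot G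
  obtain ⟨M, -, hM, hMp⟩ := exists_normal_card_prime_le (fun H _ => h H) N hNcomm hNbot
  have hMcyc : IsCyclic M := have := Fact.mk hMp; isCyclic_of_prime_card rfl
  have hquot (L : Subgroup G) [L.Normal] (hL : L ≠ ⊥) : derivedSeries G 2 ≤ L := by
    refine derivedSeries_le_of_quotient L (ih _ ?_
      (h.of_surjective _ (QuotientGroup.mk'_surjective L)) rfl)
    rw [← L.index_mul_card]
    exact lt_mul_of_one_lt_right Nat.card_pos ((Subgroup.one_lt_card_iff_ne_bot L).2 hL)
  have hMbot : M ≠ ⊥ := by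
    rintro rfl
    exact Nat.not_prime_one (Subgroup.card_bot (G := G) ▸ hMp)
  have hcent := commutator_le_centralizer_of_isCyclic M
  have hMcent : M ≤ Subgroup.centralizer (M : Set G) := Subgroup.le_centralizer M
  obtain ⟨K, hK⟩ := h M
  have hC : (K ⊓ Subgroup.centralizer (M : Set G)).Normal :=
    hK.normal_inf fun a ha b hb => Subgroup.mem_centralizer_iff.1 hb.2 a ha
  -- If trivial, `M` is its own centralizer and contains `G'`. Otherwise, by induction, `G''` lies
  -- in two normal subgroups meeting trivially.
  by_cases hbot : K ⊓ Subgroup.centralizer (M : Set G) = ⊥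
  · have hle : commutator G ≤ M := fun y hy => by
      obtain ⟨a, ha, b, hb, rfl⟩ := hK.exists_mul_eq_of_le hMcent (hcent hy)
      rw [hbot, Subgroup.mem_bot] at hb
      rwa [hb, mul_one]
    rw [derivedSeries_succ, derivedSeries_one, Subgroup.commutator_eq_bot_iff_le_centralizer]
    exact hcent.trans (Subgroup.centralizer_le hle)
  · rw [eq_bot_iff, ← hK.2]
    exact le_inf (hquot M hMbot) ((hquot _ hbot).trans inf_le_left)

end FiniteGroups

/-! ### Splitting off a semisimple normal subgroup -/

section Splitting

variable {G : Type*} [Group G]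

/-- In a normal subgroup generated by minimal normal subgroups of prime order, every intersection
with a subgroup has a normal complement. -/
theorem exists_normal_complement_inf (A H : Subgroup G)
    (hA : A ≤ sSup {M | M ≤ A ∧ M.Normal ∧ (Nat.card M).Prime}) :
    ∃ L ≤ A, L.Normal ∧ H ⊓ L = ⊥ ∧ A ≤ H ⊔ L := by
  obtain ⟨L, -, hL⟩ := zorn_le_nonempty₀ {L : Subgroup G | L ≤ A ∧ L.Normal ∧ H ⊓ L = ⊥}
    (fun c hc hchain L hLc => by
      have hmem {x : G} : x ∈ sSup c ↔ ∃ s ∈ c, x ∈ s :=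
        Subgroup.mem_sSup_of_directedOn ⟨L, hLc⟩ hchain.directedOn
      refine ⟨sSup c, ⟨sSup_le fun s hs => (hc hs).1, ⟨fun n hn g => ?_⟩, ?_⟩,
        fun s hs => le_sSup hs⟩
      · obtain ⟨s, hs, hns⟩ := hmem.1 hn
        exact hmem.2 ⟨s, hs, (hc hs).2.1.conj_mem n hns g⟩
      · refine (Subgroup.eq_bot_iff_forall _).2 fun x hx => ?_
        obtain ⟨s, hs, hxs⟩ := hmem.1 hx.2
        rw [← Subgroup.mem_bot, ← (hc hs).2.2]
        exact ⟨hx.1, hxs⟩) ⊥ ⟨bot_le, inferInstance, inf_bot_eq H⟩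
  obtain ⟨hLA, hLn, hLH⟩ := hL.prop
  refine ⟨L, hLA, hLn, hLH, hA.trans (sSup_le ?_)⟩
  rintro M ⟨hMA, hMn, hMp⟩
  by_contra hM
  -- Prime order leaves only this option; then `LM` still avoids `H`, against maximality of `L`.
  have hMbot : M ⊓ (H ⊔ L) = ⊥ := by
    have := Fact.mk hMp
    rcases (H ⊔ L).subgroupOf M |>.eq_bot_or_eq_top_of_prime_card with h | h
    · rw [inf_comm]; exact disjoint_iff.1 (Subgroup.subgroupOf_eq_bot.1 h)
    · exact absurd (Subgroup.subgroupOf_eq_top.1 h) hM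
  have hLM : L ⊔ M ≤ L := hL.le_of_ge ⟨sup_le hLA hMA, inferInstance, ?_⟩ le_sup_left
  · exact hM ((le_sup_right.trans hLM).trans le_sup_right)
  · refine (Subgroup.eq_bot_iff_forall _).2 fun x ⟨hxH, hx⟩ => ?_
    obtain ⟨l, hl, m, hm, rfl⟩ := Subgroup.mem_sup_of_normal_left.1 hx
    have hm1 : m ∈ M ⊓ (H ⊔ L) := ⟨hm, by
      have := (H ⊔ L).mul_mem (Subgroup.mem_sup_right (L.inv_mem hl))
        (Subgroup.mem_sup_left (T := L) hxH)
      rwa [inv_mul_cancel_left] at this⟩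
    rw [hMbot, Subgroup.mem_bot] at hm1
    subst hm1
    rw [mul_one] at hxH ⊢
    rw [← Subgroup.mem_bot, ← hLH]
    exact ⟨hxH, hl⟩

theorem isCGroup_of_le_sSup_normal_card_prime (A : Subgroup G) [A.Normal]
    (hA : A ≤ sSup {M | M ≤ A ∧ M.Normal ∧ (Nat.card M).Prime})
    (hc : ∀ H, A ≤ H → ∃ K, IsPermutableComplement H K) : IsCGroup G := by
  intro H
  obtain ⟨L, hLA, hLn, hHL, hAHL⟩ := exists_normal_complement_inf A H hA
  obtain ⟨C, hC⟩ := hc (H ⊔ A) le_sup_right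
  refine ⟨L ⊔ C, .mk' (fun x => ?_) fun x hxH hx => ?_⟩
  · obtain ⟨y, hy, c, hc, rfl⟩ := hC.exists_mul_eq x
    obtain ⟨h, hh, l, hl, rfl⟩ :=
      Subgroup.mem_sup_of_normal_right.1 (sup_le le_sup_left hAHL hy : y ∈ H ⊔ L)
    exact ⟨h, hh, l * c, Subgroup.mul_mem_sup hl hc, (mul_assoc h l c).symm⟩
  · obtain ⟨l, hl, c, hc, rfl⟩ := Subgroup.mem_sup_of_normal_left.1 hx
    have hcHA : c ∈ H ⊔ A := by
      have := (H ⊔ A).mul_mem (Subgroup.mem_sup_right (A.inv_mem (hLA hl)))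
        (Subgroup.mem_sup_left (T := A) hxH)
      rwa [inv_mul_cancel_left] at this
    obtain rfl : c = 1 := hC.eq_one hcHA hc
    rw [mul_one] at hxH ⊢
    rw [← Subgroup.mem_bot, ← hHL]
    exact ⟨hxH, hl⟩

end Splitting

/-! ### Torsion -/

theorem IsCGroup.isMulTorsion {G : Type*} [Group G] (h : IsCGroup G) : IsMulTorsion G := by
  intro g
  by_contra hg
  have hinj : Function.Injective fun n : ℤ => g ^ n := injective_zpow_iff_not_isOfFinOrder.2 hg
  obtain ⟨K, hK⟩ := h (Subgroup.zpowers (g ^ 2))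
  have hle : Subgroup.zpowers (g ^ 2) ≤ Subgroup.zpowers g := by
    rw [Subgroup.zpowers_le]
    exact Subgroup.npow_mem_zpowers g 2
  obtain ⟨_, ⟨m, rfl⟩, _, ⟨hb, n, rfl⟩, hab⟩ :=
    hK.exists_mul_eq_of_le hle (Subgroup.mem_zpowers g)
  simp only at hb hab
  -- The square of `g ^ n ∈ K` lies in both factors; so `n = 0`, and `2 * m = 1` is absurd.
  have hn : g ^ (2 * n) = 1 := by
    refine hK.eq_one ⟨n, ?_⟩ ?_
    · simp only
      rw [zpow_mul]; norm_cast
    · rw [mul_comm, zpow_mul]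
      exact K.zpow_mem hb 2
  have hn0 : 2 * n = 0 := hinj (hn.trans (zpow_zero g).symm)
  have hmn : 2 * m + n = 1 := by
    refine hinj ?_
    simp only
    rw [zpow_add, zpow_mul, zpow_one]
    exact_mod_cast hab
  omega

/-- In a torsion group, the normal closure of an element of an abelian normal subgroup of finite
index is finite. -/
theorem finite_normalClosure_singleton {G : Type*} [Group G] (hG : IsMulTorsion G)
    (D : Subgroup G) [D.Normal] [D.FiniteIndex] (hcomm : ∀ a ∈ D, ∀ b ∈ D, a * b = b * a)
    {x : G} (hx : x ∈ D) : Finite (Subgroup.normalClosure {x}) := by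
  have hle : Subgroup.normalClosure {x} ≤ D :=
    Subgroup.normalClosure_le_normal (Set.singleton_subset_iff.2 hx)
  have hfin : (Group.conjugatesOfSet {x}).Finite := by
    -- `D` is abelian, so a conjugate of `x` depends only on the coset of the conjugating element.
    refine (Set.finite_range fun q : G ⧸ D => q.out * x * q.out⁻¹).subset fun y hy => ?_
    obtain ⟨_, rfl, hxy⟩ := Group.mem_conjugatesOfSet_iff.1 hy
    obtain ⟨g, rfl⟩ := isConj_iff.1 hxy
    obtain ⟨d, hd⟩ := QuotientGroup.mk_out_eq_mul D g
    refine ⟨g, ?_⟩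
    simp only [hd]
    rw [mul_inv_rev, mul_assoc g, hcomm _ d.2 _ hx]
    group
  have hfg : (Subgroup.normalClosure {x}).FG :=
    (Subgroup.fg_iff _).2 ⟨_, rfl, hfin⟩
  let _ : CommGroup (Subgroup.normalClosure {x}) :=
    { mul_comm := fun a b => Subtype.ext (hcomm _ (hle a.2) _ (hle b.2)) }
  have := (Group.fg_iff_subgroup_fg _).2 hfg
  exact CommGroup.finite_of_fg_isMulTorsion _ (hG.subgroup _)

/-! ### Profinite C-groups -/

section Profinite

variable {G : Type*} [Group G] [TopologicalSpace G]

theorem IsProfiniteCGroup.isCGroup_quotient (hG : IsProfiniteCGroup G) (U : Subgroup G) [U.Normal]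
    (hU : IsOpen (U : Set G)) : IsCGroup (G ⧸ U) := fun H => by
  have := hG.isTopologicalGroup
  have hle : U ≤ H.comap (QuotientGroup.mk' U) := fun u hu => by
    rw [Subgroup.mem_comap, QuotientGroup.mk'_apply, (QuotientGroup.eq_one_iff u).2 hu]
    exact H.one_mem
  obtain ⟨K, -, hK⟩ := hG.exists_closed_complement _
    (Subgroup.isClosed_of_isOpen _ (Subgroup.isOpen_mono hle hU))
  exact ⟨_, hK.map (QuotientGroup.mk'_surjective U)⟩

/-- Open normal subgroups separate points, and the quotients by them are finite C-groups. -/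
theorem IsProfiniteCGroup.derivedSeries_two_eq_bot (hG : IsProfiniteCGroup G) :
    derivedSeries G 2 = ⊥ := by
  have := hG.isTopologicalGroup
  have := hG.compactSpace
  have := hG.totallyDisconnectedSpace
  refine (Subgroup.eq_bot_iff_forall _).2 fun x hx => ?_
  by_contra hx1
  obtain ⟨U, hU⟩ := ProfiniteGrp.exist_openNormalSubgroup_sub_open_nhds_of_one
    (isOpen_compl_singleton (x := x)) (fun h : (1 : G) = x => hx1 h.symm)
  have hUo : IsOpen ((U : Subgroup G) : Set G) := U.isOpen'
  have : Finite (G ⧸ (U : Subgroup G)) := Subgroup.quotient_finite_of_isOpen _ hUo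
  exact hU (derivedSeries_le_of_quotient (U : Subgroup G)
    (hG.isCGroup_quotient U hUo).derivedSeries_two_eq_bot hx) rfl

end Profinite

theorem mainTheorem8 (G : Type*) [Group G] [TopologicalSpace G]
    (hG : IsProfiniteCGroup G)
    (hopen : IsOpen (closure ((commutator G : Subgroup G) : Set G))) :
    IsCGroup G ↔ IsMulTorsion G := by
  refine ⟨IsCGroup.isMulTorsion, fun ht => ?_⟩
  have := hG.isTopologicalGroup
  have := hG.compactSpace
  have := hG.totallyDisconnectedSpace
  let D : Subgroup G := (commutator G).topologicalClosure
  have hDo : IsOpen (D : Set G) := hopen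
  have hDn : D.Normal := Subgroup.is_normal_topologicalClosure _
  have hDq : Finite (G ⧸ D) := Subgroup.quotient_finite_of_isOpen D hDo
  have hDi : D.FiniteIndex := Subgroup.finiteIndex_of_finite_quotient
  have hDcomm : ∀ a ∈ D, ∀ b ∈ D, a * b = b * a := by
    have h := hG.derivedSeries_two_eq_bot
    rw [derivedSeries_succ, derivedSeries_one, Subgroup.commutator_eq_bot_iff_le_centralizer] at h
    -- Commutativity passes to the closure.
    let _ := Subgroup.commGroupTopologicalClosure (commutator G)
      fun a b => Subtype.ext (Subgroup.mem_centralizer_iff.1 (h b.2) a a.2)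
    exact fun a ha b hb => congrArg Subtype.val (mul_comm (⟨a, ha⟩ : D) ⟨b, hb⟩)
  have hfin (H : Subgroup G) (hH : Finite H) : ∃ K, IsPermutableComplement H K :=
    let ⟨K, _, hK⟩ := hG.exists_closed_complement H (Set.toFinite (H : Set G)).isClosed
    ⟨K, hK⟩
  have hDsup : D ≤ sSup {M | M ≤ D ∧ M.Normal ∧ (Nat.card M).Prime} := fun x hx => by
    have hle : Subgroup.normalClosure {x} ≤ D :=
      Subgroup.normalClosure_le_normal (Set.singleton_subset_iff.2 hx)
    have := finite_normalClosure_singleton ht D hDcomm hx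
    have hsup := le_sSup_normal_card_prime hfin (Subgroup.normalClosure {x})
      fun a ha b hb => hDcomm a (hle ha) b (hle hb)
    exact sSup_le (fun M hM => le_sSup (⟨hM.1.trans hle, hM.2⟩ : M ≤ D ∧ _))
      (hsup (Subgroup.subset_normalClosure rfl))
  refine isCGroup_of_le_sSup_normal_card_prime D hDsup fun H hH => ?_
  obtain ⟨K, -, hK⟩ := hG.exists_closed_complement H
    (Subgroup.isClosed_of_isOpen H (Subgroup.isOpen_mono hH hDo))
  exact ⟨K, hK⟩
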